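/- Let $W(y|x)$, $x\in\mathcal X$, $y\in\mathcal Y$, be a discrete memoryless channel with finite input alphabet $\mathcal X$ and finite output alphabet $\mathcal Y$, and let $\rho>0$. All logarithms are natural, and $W(\mathcal B|x)=\sum_{y\in\mathcal B}W(y|x)$ for $\mathcal B\subseteq\mathcal Y$. A blocklength-$n$ rate-$R$ encoder is a map $f\colon\{1,\dots,M\}\to\mathcal X^n$ with $M=\lfloor e^{nR}\rfloor$; message $m$ then produces $\mathbf y\in\mathcal Y^n$ with probability $p(\mathbf y|m)=\prod_{i=1}^n W(y_i|f(m)_i)$. A blocklength-$n$ rate-$R$ feedback encoder is a tuple $(f^{(1)},\dots,f^{(n)})$ of maps $f^{(i)}\colon\{1,\dots,M\}\times\mathcal Y^{i-1}\to\mathcal X$; then $p(\mathbf y|m)=\prod_{i=1}^n W\bigl(y_i|f^{(i)}(m,y_1,\dots,y_{i-1})\bigr)$. In both cases let $\mathcal L(\mathbf y)=\{m: p(\mathbf y|m)>0\}$. The listsize capacity $C_{\mathrm{list}}(\rho)$ is the supremum of all rates $R$ for which there is a sequence of blocklength-$n$ rate-$R$ encoders with $$\lim_{n\to\infty}\frac1{\lfloor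 e^{nR}\rfloor}\sum_{m}\sum_{\mathbf y\in\mathcal Y^n}p(\mathbf y|m)\,|\mathcal L(\mathbf y)|^\rho=1,$$ and the listsize capacity with feedback $C_{\mathrm{list,fb}}(\rho)$ is defined in the same way with feedback encoders. The zero-error capacity $C_0$ is the supremum of $\frac1n\log M$ over all $n,M\ge1$ for which there is a map $f\colon\{1,\dots,M\}\to\mathcal X^n$ such that every $\mathbf y\in\mathcal Y^n$ can be produced (without feedback) by at most one message. For $\xi>0$ and a probability mass function $P$ on $\mathcal X$ let $$E_0(\xi,P)=-\log\sum_{y\in\mathcal Y}\Bigl(\sum_{x\in\mathcal X}P(x)W(y|x)^{\frac1{1+\xi}}\Bigr)^{1+\xi},\qquad R^\star(\rho)=\sup_{\xi>0}\max_P\frac{E_0(\xi,P)}{\xi+\rho},$$ and let $q^\star$ be the maximum of $W(\mathcal Y_0|x_1)$ over all $x_1\in\mathcal X$ and all subsets $\mathcal Y_0\subseteq\mathcal Y$ for which there exists $x_0\in\mathcal X$ with $W(\mathcal Y_0|x_0)=0$. Theorem. If $C_{\mathrm{list}}(\rho)>0$, then $$C_{\mathrm{list,fb}}(\rho)\ \ge\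 \frac{R^\star(\rho)}{1+\dfrac{\rho R^\star(\rho)}{\log\frac1{1-q^\star}}},$$ where the right-hand side is interpreted as $R^\star(\rho)$ when $q^\star=1$. Moreover, if $C_0>0$, then $q^\star=1$. -/

import Mathlib

open Filter Topology

noncomputable section

/-- A discrete memoryless channel with finite input alphabet `X` and finite output alphabet `Y`:
`W.prob x y` is the transition probability `W(y|x)`. -/
structure DMC (X Y : Type*) [Fintype X] [Fintype Y] where
  prob : X → Y → ℝ
  nonneg : ∀ x y, 0 ≤ prob x y
  sum_eq_one : ∀ x, ∑ y, prob x y = 1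

/-- An encoder of blocklength `n` with `M` messages (no feedback). -/
abbrev BlockEncoder (X : Type*) (n M : ℕ) := Fin M → Fin n → X

/-- A feedback encoder of blocklength `n` with `M` messages: the input at time `i` depends on the
message and on the outputs observed strictly before time `i`. -/
abbrev FeedbackEncoder (X Y : Type*) (n M : ℕ) := (i : Fin n) → Fin M → (Fin i → Y) → X

/-- The number of messages of a blocklength-`n` rate-`R` encoder, the integer part of `e^(nR)`. -/
def numMessages (n : ℕ) (R : ℝ) : ℕ := ⌊Real.exp (n * R)⌋₊

/-- The list of all messages that can produce `y`, when `p m y` is the probability of the output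
sequence `y` given the message `m`. -/
def messageList {M : ℕ} {S : Type*} (p : Fin M → S → ℝ) (y : S) : Finset (Fin M) :=
  Finset.univ.filter fun m => 0 < p m y

/-- The `ρ`-th moment of the length of the list, under uniformly distributed messages. -/
def listMoment {M : ℕ} {S : Type*} [Fintype S] (ρ : ℝ) (p : Fin M → S → ℝ) : ℝ :=
  (M : ℝ)⁻¹ * ∑ m, ∑ y, p m y * ((messageList p y).card : ℝ) ^ ρ

namespace DMC

variable {X Y : Type*} [Fintype X] [Fintype Y]

/-- Probability of the output sequence `y` when message `m` is sent without feedback. -/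
def blockProb (W : DMC X Y) {n M : ℕ} (f : BlockEncoder X n M) (m : Fin M) (y : Fin n → Y) : ℝ :=
  ∏ i, W.prob (f m i) (y i)

/-- Probability of the output sequence `y` when message `m` is sent with feedback. -/
def feedbackProb (W : DMC X Y) {n M : ℕ} (f : FeedbackEncoder X Y n M) (m : Fin M)
    (y : Fin n → Y) : ℝ :=
  ∏ i, W.prob (f i m fun j => y (Fin.castLE i.isLt.le j)) (y i)

/-- The listsize capacity (without feedback), as an extended real number. -/
def listCapacity (W : DMC X Y) (ρ : ℝ) : EReal :=
  sSup {c : EReal | ∃ R : ℝ, c = (R : EReal) ∧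
    ∃ f : (n : ℕ) → BlockEncoder X n (numMessages n R),
      Tendsto (fun n => listMoment ρ (W.blockProb (f n))) atTop (𝓝 1)}

/-- The listsize capacity with feedback, as an extended real number. -/
def listCapacityFeedback (W : DMC X Y) (ρ : ℝ) : EReal :=
  sSup {c : EReal | ∃ R : ℝ, c = (R : EReal) ∧
    ∃ f : (n : ℕ) → FeedbackEncoder X Y n (numMessages n R),
      Tendsto (fun n => listMoment ρ (W.feedbackProb (f n))) atTop (𝓝 1)}

/-- A zero-error code: every output sequence can be produced by at most one message. -/
def IsZeroError (W : DMC X Y) {n M : ℕ} (f : BlockEncoder X n M) : Prop :=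
  ∀ (y : Fin n → Y) (m m' : Fin M), 0 < W.blockProb f m y → 0 < W.blockProb f m' y → m = m'

/-- The zero-error capacity: the supremum of the rates `(log M) / n` of zero-error codes. -/
def zeroErrorCapacity (W : DMC X Y) : EReal :=
  sSup {c : EReal | ∃ n M : ℕ, 0 < n ∧ 0 < M ∧
    (∃ f : BlockEncoder X n M, W.IsZeroError f) ∧ c = ((Real.log M / n : ℝ) : EReal)}

/-- Gallager's function `E₀(ξ, P)`. -/
def E0 (W : DMC X Y) (ξ : ℝ) (P : X → ℝ) : ℝ :=
  -Real.log (∑ y, (∑ x, P x * W.prob x y ^ (1 / (1 + ξ))) ^ (1 + ξ))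

/-- `R⋆(ρ)`: the supremum over `ξ > 0` of the maximum over all PMFs `P` of `E₀(ξ, P) / (ξ + ρ)`. -/
def Rstar (W : DMC X Y) (ρ : ℝ) : ℝ :=
  ⨆ ξ : Set.Ioi (0 : ℝ), ⨆ P : stdSimplex ℝ X, W.E0 ξ P / (ξ + ρ)

/-- `q⋆`: the maximal probability, under any input `x₁`, of a set of outputs none of which some
input `x₀` can produce. -/
def qstar (W : DMC X Y) : ℝ :=
  sSup {q : ℝ | ∃ (x₁ x₀ : X) (Y₀ : Finset Y),
    ∑ y ∈ Y₀, W.prob x₀ y = 0 ∧ q = ∑ y ∈ Y₀, W.prob x₁ y}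

/-! The suprema of real numbers above are genuine: the set for `q⋆` has a greatest element, the
maximum over `P` is attained, and the supremum over `ξ` is over a bounded set. -/

theorem qstar_isGreatest [Nonempty X] (W : DMC X Y) :
    IsGreatest {q : ℝ | ∃ (x₁ x₀ : X) (Y₀ : Finset Y),
      ∑ y ∈ Y₀, W.prob x₀ y = 0 ∧ q = ∑ y ∈ Y₀, W.prob x₁ y} W.qstar := by
  have hfin : {q : ℝ | ∃ (x₁ x₀ : X) (Y₀ : Finset Y),
      ∑ y ∈ Y₀, W.prob x₀ y = 0 ∧ q = ∑ y ∈ Y₀, W.prob x₁ y}.Finite := by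
    refine (Set.finite_range
      (fun t : X × Finset Y => ∑ y ∈ t.2, W.prob t.1 y)).subset ?_
    rintro q ⟨x₁, x₀, Y₀, -, rfl⟩
    exact ⟨(x₁, Y₀), rfl⟩
  have hne : {q : ℝ | ∃ (x₁ x₀ : X) (Y₀ : Finset Y),
      ∑ y ∈ Y₀, W.prob x₀ y = 0 ∧ q = ∑ y ∈ Y₀, W.prob x₁ y}.Nonempty := by
    obtain ⟨x⟩ := ‹Nonempty X›
    exact ⟨0, x, x, ∅, by simp, by simp⟩
  exact ⟨hne.csSup_mem hfin, fun q hq => le_csSup hfin.bddAbove hq⟩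

theorem E0_sum_lower (W : DMC X Y) {ξ : ℝ} (hξ : 0 < ξ) (P : stdSimplex ℝ X) :
    0 < (Fintype.card Y : ℝ) ∧ (Fintype.card Y : ℝ) ^ (-ξ) ≤
      ∑ y, (∑ x, P.1 x * W.prob x y ^ (1 / (1 + ξ))) ^ (1 + ξ) := by
  have hP0 := P.2.1
  have hq0 : ∀ y, 0 ≤ ∑ x, P.1 x * W.prob x y := fun y =>
    Finset.sum_nonneg fun x _ => mul_nonneg (hP0 x) (W.nonneg x y)
  have hq1 : ∑ y, ∑ x, P.1 x * W.prob x y = 1 := by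
    rw [Finset.sum_comm]
    simp only [← Finset.mul_sum, W.sum_eq_one, mul_one]
    exact P.2.2
  have hY : 0 < (Fintype.card Y : ℝ) := by
    rcases isEmpty_or_nonempty Y with h | h
    · simp at hq1
    · exact_mod_cast Fintype.card_pos
  have hle1 : ∀ x y, W.prob x y ≤ 1 := fun x y => by
    rw [← W.sum_eq_one x]
    exact Finset.single_le_sum (fun z _ => W.nonneg x z) (Finset.mem_univ y)
  refine ⟨hY, ?_⟩
  have h1 : (1 : ℝ) ≤ (Fintype.card Y : ℝ) ^ ξ * ∑ y, (∑ x, P.1 x * W.prob x y) ^ (1 + ξ) := by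
    have := Real.rpow_sum_le_const_mul_sum_rpow_of_nonneg (Finset.univ : Finset Y)
      (f := fun y => ∑ x, P.1 x * W.prob x y) (p := 1 + ξ) (by linarith) (fun y _ => hq0 y)
    simpa [hq1] using this
  have h2 : ∑ y, (∑ x, P.1 x * W.prob x y) ^ (1 + ξ) ≤
      ∑ y, (∑ x, P.1 x * W.prob x y ^ (1 / (1 + ξ))) ^ (1 + ξ) := by
    refine Finset.sum_le_sum fun y _ => Real.rpow_le_rpow (hq0 y) ?_ (by linarith)
    refine Finset.sum_le_sum fun x _ => mul_le_mul_of_nonneg_left ?_ (hP0 x)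
    apply Real.self_le_rpow_of_le_one (W.nonneg x y) (hle1 x y)
    rw [div_le_one (by linarith)]; linarith
  rw [Real.rpow_neg hY.le, inv_le_iff_one_le_mul₀' (Real.rpow_pos_of_pos hY ξ)]
  exact h1.trans (mul_le_mul_of_nonneg_left h2 (Real.rpow_nonneg hY.le ξ))

theorem E0_max_attained [Nonempty X] (W : DMC X Y) {ξ : ℝ} (hξ : 0 < ξ) (ρ : ℝ) :
    IsGreatest (Set.range fun P : stdSimplex ℝ X => W.E0 ξ P / (ξ + ρ))
      (⨆ P : stdSimplex ℝ X, W.E0 ξ P / (ξ + ρ)) := by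
  have hc : Continuous fun P : stdSimplex ℝ X => W.E0 ξ P / (ξ + ρ) := by
    unfold E0
    refine (Continuous.neg (Continuous.log ?_ fun P => ?_)).div_const _
    · refine continuous_finsetSum _ fun y _ => Continuous.rpow_const ?_ fun _ => Or.inr (by linarith)
      refine continuous_finsetSum _ fun x _ => Continuous.mul ?_ continuous_const
      exact (continuous_apply x).comp continuous_subtype_val
    · obtain ⟨hY, h⟩ := W.E0_sum_lower hξ P
      exact ((Real.rpow_pos_of_pos hY _).trans_le h).ne'
  have : Nonempty (stdSimplex ℝ X) := by classical exact ⟨stdSimplex.vertex (Classical.arbitrary X)⟩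
  have : CompactSpace (stdSimplex ℝ X) := isCompact_iff_compactSpace.1 (isCompact_stdSimplex ℝ X)
  exact (isCompact_range hc).isGreatest_sSup (Set.range_nonempty _)

theorem Rstar_isLUB [Nonempty X] (W : DMC X Y) {ρ : ℝ} (hρ : 0 < ρ) :
    IsLUB (Set.range fun ξ : Set.Ioi (0 : ℝ) => ⨆ P : stdSimplex ℝ X, W.E0 ξ P / (ξ + ρ))
      (W.Rstar ρ) := by
  refine isLUB_ciSup ⟨Real.log (Fintype.card Y), ?_⟩
  rintro _ ⟨⟨ξ, hξ⟩, rfl⟩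
  obtain ⟨P, hP⟩ := (W.E0_max_attained hξ ρ).1
  have hξ' : 0 < ξ := hξ
  obtain ⟨hY, h⟩ := W.E0_sum_lower hξ' P
  have hlog := Real.log_le_log (Real.rpow_pos_of_pos hY _) h
  rw [Real.log_rpow hY] at hlog
  have hlogY : 0 ≤ Real.log (Fintype.card Y) := Real.log_natCast_nonneg _
  have hE : W.E0 ξ P ≤ ξ * Real.log (Fintype.card Y) := by
    change -Real.log (∑ y, (∑ x, P.1 x * W.prob x y ^ (1 / (1 + ξ))) ^ (1 + ξ)) ≤ _
    linarith
  show (⨆ P : stdSimplex ℝ X, W.E0 ξ P / (ξ + ρ)) ≤ _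
  rw [← hP]
  show W.E0 ξ P / (ξ + ρ) ≤ _
  rw [div_le_iff₀ (by linarith)]
  nlinarith

end DMC

end

/-! The proof builds a two-stage code. In the first stage, random coding over a fraction `α` of the
time narrows the messages to a list of constant size `L ≥ ξ`. A failure costs a factor at most `M ^
ρ` in the moment, so by Gallager's list-decoding bound its contribution has exponent `(ρ + ξ) * (R -
α * r)` with `r = E₀ / (ξ + ρ)`. It vanishes when `α > R / r`, which is how `R⋆` enters. Feedback
reveals the list to the encoder, which then certifies claims: it sends `x₁` if the claim holds and
`x₀` otherwise, so an output in `Y₀` proves the claim. With `l = log (1 / (1 - q⋆))`, the claim "the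
message is on the list", repeated over a fraction `β`, stays unproved with probability `e ^ (-n * β
* l)` at cost `M ^ ρ`; this vanishes when `β > ρ * R / l`. Singling out one of the `L` candidates
costs only `L ^ ρ` on failure, so any positive fraction of the time suffices. The rates allowed are
those with `R / r + ρ * R / l < 1`; letting `r` approach `R⋆` gives the bound. Positive listsize
capacity is used only to ensure an input exists and `q⋆ > 0`. The main steps are
`exists_codebook_error_le`, `exists_feedbackEncoder_listMoment_le` and
`exists_feedbackEncoder_tendsto`. -/

/-! ### Random coding with list decoding, for an abstract channel. -/

/-- Union bound over subsets of size `L`: among independent letters of law `Q`, at least `L` satisfy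
`p` with probability at most `(card I * Q p) ^ L`. -/
theorem sum_prod_count_le {I A : Type*} [Fintype I] [DecidableEq I] [Fintype A] {Q : A → ℝ}
    (hQ : ∀ x, 0 ≤ Q x) (hQ1 : ∑ x, Q x = 1) (p : A → Prop) [DecidablePred p] (L : ℕ) :
    ∑ c : I → A, (∏ i, Q (c i)) * (if L ≤ (Finset.univ.filter fun i => p (c i)).card then 1 else 0)
      ≤ (Fintype.card I * ∑ x, Q x * (if p x then 1 else 0)) ^ L := by
  classical
  set a := ∑ x, Q x * (if p x then (1 : ℝ) else 0) with ha
  have ha0 : 0 ≤ a := Finset.sum_nonneg fun x _ => mul_nonneg (hQ x) (by split_ifs <;> norm_num)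
  -- If at least `L` letters satisfy `p`, then some `L`-subset `T` consists of such letters; its
  -- product is the whole weight of `c`.
  have key : ∀ c : I → A,
      (∏ i, Q (c i)) * (if L ≤ (Finset.univ.filter fun i => p (c i)).card then (1 : ℝ) else 0) ≤
      ∑ T ∈ Finset.powersetCard L (Finset.univ : Finset I),
        ∏ i, Q (c i) * (if i ∈ T then (if p (c i) then 1 else 0) else 1) := by
    intro c
    have hterm : ∀ T : Finset I,
        0 ≤ ∏ i, Q (c i) * (if i ∈ T then (if p (c i) then (1 : ℝ) else 0) else 1) := fun T =>
      Finset.prod_nonneg fun i _ => mul_nonneg (hQ _) (by split_ifs <;> norm_num)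
    split_ifs with h
    · obtain ⟨T, hT, hTc⟩ := Finset.exists_subset_card_eq h
      refine le_trans (le_of_eq ?_) (Finset.single_le_sum (fun T _ => hterm T)
        (Finset.mem_powersetCard.2 ⟨Finset.subset_univ T, hTc⟩))
      rw [mul_one]
      refine Finset.prod_congr rfl fun i _ => ?_
      by_cases hi : i ∈ T
      · have := (Finset.mem_filter.1 (hT hi)).2
        simp [hi, this]
      · simp [hi]
    · rw [mul_zero]
      exact Finset.sum_nonneg fun T _ => hterm T
  refine (Finset.sum_le_sum fun c _ => key c).trans ?_
  rw [Finset.sum_comm]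
  have hT : ∀ T ∈ Finset.powersetCard L (Finset.univ : Finset I),
      ∑ c : I → A, ∏ i, Q (c i) * (if i ∈ T then (if p (c i) then (1 : ℝ) else 0) else 1) =
        a ^ L := by
    intro T hT
    rw [← Fintype.prod_sum
      (fun i x => Q x * (if i ∈ T then (if p x then (1 : ℝ) else 0) else 1))]
    have : ∀ i, ∑ x, Q x * (if i ∈ T then (if p x then (1 : ℝ) else 0) else 1) =
        if i ∈ T then a else 1 := by
      intro i
      by_cases hi : i ∈ T
      · simp only [hi, if_true, ha]
      · simp only [hi, if_false, mul_one, hQ1]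
    simp only [this]
    rw [Finset.prod_ite_mem, Finset.univ_inter, Finset.prod_const, (Finset.mem_powersetCard.1 hT).2]
  rw [Finset.sum_congr rfl hT, Finset.sum_const, Finset.card_powersetCard, nsmul_eq_mul, mul_pow,
    Finset.card_univ]
  gcongr
  exact_mod_cast Nat.choose_le_pow _ _

/-- A probability bounded by `a ^ L` is at most `min 1 (a ^ L) ≤ a ^ ξ` whenever `0 < ξ ≤ L`. This
frees the exponent from being an integer. -/
theorem sum_prod_count_le_rpow {I A : Type*} [Fintype I] [DecidableEq I] [Fintype A] {Q : A → ℝ}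
    (hQ : ∀ x, 0 ≤ Q x) (hQ1 : ∑ x, Q x = 1) (p : A → Prop) [DecidablePred p] {L : ℕ} {ξ : ℝ}
    (hξ : 0 < ξ) (hL : ξ ≤ L) :
    ∑ c : I → A, (∏ i, Q (c i)) * (if L ≤ (Finset.univ.filter fun i => p (c i)).card then 1 else 0)
      ≤ (Fintype.card I * ∑ x, Q x * (if p x then 1 else 0)) ^ ξ := by
  have ha0 : 0 ≤ Fintype.card I * ∑ x, Q x * (if p x then (1 : ℝ) else 0) :=
    mul_nonneg (Nat.cast_nonneg _)
      (Finset.sum_nonneg fun x _ => mul_nonneg (hQ x) (by split_ifs <;> norm_num))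
  rcases le_total (Fintype.card I * ∑ x, Q x * (if p x then (1 : ℝ) else 0)) 1 with h | h
  · refine (sum_prod_count_le hQ hQ1 p L).trans ?_
    rw [← Real.rpow_natCast]
    exact Real.rpow_le_rpow_of_exponent_ge' ha0 h hξ.le hL
  · refine le_trans ?_ (Real.one_le_rpow h hξ.le)
    calc _ ≤ ∑ c : I → A, ∏ i, Q (c i) := by
          refine Finset.sum_le_sum fun c _ => mul_le_of_le_one_right
            (Finset.prod_nonneg fun i _ => hQ _) (by split_ifs <;> norm_num)
      _ = 1 := by rw [← Fintype.prod_sum (fun _ x => Q x)]; simp [hQ1]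

/-- The messages for which fewer than `L` other messages are at least as likely under `v`. -/
noncomputable def likelyList {M : ℕ} (L : ℕ) (v : Fin M → ℝ) : Finset (Fin M) :=
  Finset.univ.filter fun m =>
    (Finset.univ.filter fun i : {j // j ≠ m} => v m ≤ v i).card < L

/-- All other members of the list are at least as likely as its least likely member, and fewer than
`L` messages are. -/
theorem card_likelyList_le {M : ℕ} (L : ℕ) (v : Fin M → ℝ) : (likelyList L v).card ≤ L := by
  classical
  rcases (likelyList L v).eq_empty_or_nonempty with h | h
  · simp [h]
  obtain ⟨m, hm, hmin⟩ := Finset.exists_min_image _ v h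
  have hlt := (Finset.mem_filter.1 hm).2
  have hsub : (likelyList L v).erase m ⊆
      (Finset.univ.filter fun i : {j // j ≠ m} => v m ≤ v i).map (Function.Embedding.subtype _) := by
    intro i hi
    obtain ⟨hne, hi⟩ := Finset.mem_erase.1 hi
    exact Finset.mem_map.2 ⟨⟨i, hne⟩, by simpa using hmin i hi, rfl⟩
  have := Finset.card_le_card hsub
  rw [Finset.card_map, Finset.card_erase_of_mem hm] at this
  omega

/-- Averaged over random codebooks, the probability that message `m` is sent, `y` is received and
`m` is not on the list of likely messages. -/
theorem sum_codebook_error_le {M : ℕ} {A S : Type*} [Fintype A] {Q : A → ℝ}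
    (hQ : ∀ x, 0 ≤ Q x) (hQ1 : ∑ x, Q x = 1) {V : A → S → ℝ} (hV : ∀ x y, 0 ≤ V x y)
    {L : ℕ} {ξ : ℝ} (hξ : 0 < ξ) (hL : ξ ≤ L) (m : Fin M) (y : S) :
    ∑ c : Fin M → A, (∏ i, Q (c i)) *
        (V (c m) y * (if m ∉ likelyList L (fun m' => V (c m') y) then 1 else 0)) ≤
      (M : ℝ) ^ ξ * (∑ x, Q x * V x y ^ (1 / (1 + ξ))) ^ (1 + ξ) := by
  classical
  set b := ∑ x, Q x * V x y ^ (1 / (1 + ξ)) with hb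
  have hb0 : 0 ≤ b := Finset.sum_nonneg fun x _ => mul_nonneg (hQ x) (Real.rpow_nonneg (hV x y) _)
  have h1ξ : 0 < 1 + ξ := by linarith
  -- Condition on the codeword `x` of `m`; the remaining codewords stay independent of law `Q`.
  rw [← (Equiv.funSplitAt m A).symm.sum_comp, Fintype.sum_prod_type]
  have hx : ∀ x : A, ∑ c : {j // j ≠ m} → A,
      (∏ i, Q ((Equiv.funSplitAt m A).symm (x, c) i)) *
        (V ((Equiv.funSplitAt m A).symm (x, c) m) y *
          (if m ∉ likelyList L (fun m' => V ((Equiv.funSplitAt m A).symm (x, c) m') y)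
            then 1 else 0)) ≤ Q x * V x y ^ (1 / (1 + ξ)) * ((M : ℝ) ^ ξ * b ^ ξ) := by
    intro x
    have hself : ∀ c : {j // j ≠ m} → A, (Equiv.funSplitAt m A).symm (x, c) m = x := by
      intro c; simp [Equiv.funSplitAt, Equiv.piSplitAt]
    have hne : ∀ (c : {j // j ≠ m} → A) (i : {j // j ≠ m}),
        (Equiv.funSplitAt m A).symm (x, c) i = c i := by
      intro c i
      simp [Equiv.funSplitAt, Equiv.piSplitAt, i.2]
    have hsum : ∑ c : {j // j ≠ m} → A,
      (∏ i, Q ((Equiv.funSplitAt m A).symm (x, c) i)) *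
        (V ((Equiv.funSplitAt m A).symm (x, c) m) y *
          (if m ∉ likelyList L (fun m' => V ((Equiv.funSplitAt m A).symm (x, c) m') y)
            then 1 else 0)) = Q x * V x y * ∑ c : {j // j ≠ m} → A, (∏ i, Q (c i)) *
        (if L ≤ (Finset.univ.filter fun i => V x y ≤ V (c i) y).card then 1 else 0) := by
      rw [Finset.mul_sum]
      refine Finset.sum_congr rfl fun c _ => ?_
      rw [Fintype.prod_eq_mul_prod_subtype_ne _ m]
      simp only [likelyList, Finset.mem_filter, Finset.mem_univ, true_and, not_lt, hself, hne]
      ring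
    rw [hsum]
    rcases (hV x y).eq_or_lt with h0 | hpos
    · rw [← h0, mul_zero, zero_mul]
      have : 0 ≤ (M : ℝ) ^ ξ * b ^ ξ := by positivity
      exact mul_nonneg (mul_nonneg (hQ x) (Real.rpow_nonneg le_rfl _)) this
    refine (mul_le_mul_of_nonneg_left (sum_prod_count_le_rpow hQ hQ1 (fun x' => V x y ≤ V x' y)
      hξ hL) (mul_nonneg (hQ x) (hV x y))).trans ?_
    have hs : 0 < V x y ^ (1 / (1 + ξ)) := Real.rpow_pos_of_pos hpos _
    -- Markov's inequality: the indicator of `V x y ≤ V x' y` is at most the likelihood ratio to the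
    -- power `1 / (1 + ξ)`.
    have ha : ∑ x', Q x' * (if V x y ≤ V x' y then (1 : ℝ) else 0) ≤
        b / V x y ^ (1 / (1 + ξ)) := by
      rw [hb, Finset.sum_div]
      refine Finset.sum_le_sum fun x' _ => ?_
      rw [mul_div_assoc]
      refine mul_le_mul_of_nonneg_left ?_ (hQ x')
      split_ifs with h
      · rw [one_le_div hs]
        exact Real.rpow_le_rpow hpos.le h (by positivity)
      · exact div_nonneg (Real.rpow_nonneg (hV x' y) _) hs.le
    have hcard : (Fintype.card {j : Fin M // j ≠ m} : ℝ) ≤ M := by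
      have := Fintype.card_subtype_le (fun j : Fin M => j ≠ m)
      rw [Fintype.card_fin] at this
      exact_mod_cast this
    have ha0 : 0 ≤ ∑ x', Q x' * (if V x y ≤ V x' y then (1 : ℝ) else 0) :=
      Finset.sum_nonneg fun x' _ => mul_nonneg (hQ x') (by split_ifs <;> norm_num)
    have hle : ((Fintype.card {j : Fin M // j ≠ m} : ℝ) *
        ∑ x', Q x' * (if V x y ≤ V x' y then (1 : ℝ) else 0)) ^ ξ ≤
        (M : ℝ) ^ ξ * (b ^ ξ / (V x y ^ (1 / (1 + ξ))) ^ ξ) := by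
      rw [← Real.div_rpow hb0 hs.le, ← Real.mul_rpow (Nat.cast_nonneg _) (div_nonneg hb0 hs.le)]
      exact Real.rpow_le_rpow (mul_nonneg (Nat.cast_nonneg _) ha0)
        (mul_le_mul hcard ha ha0 (Nat.cast_nonneg _)) hξ.le
    -- The power `1 / (1 + ξ)` is chosen so that the factor left after cancelling the denominator is
    -- again the summand of `b`.
    have hsplit : V x y = V x y ^ (1 / (1 + ξ)) * (V x y ^ (1 / (1 + ξ))) ^ ξ := by
      rw [← Real.rpow_mul hpos.le, ← Real.rpow_add hpos]
      have : 1 / (1 + ξ) + 1 / (1 + ξ) * ξ = 1 := by field_simp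
      rw [this, Real.rpow_one]
    refine (mul_le_mul_of_nonneg_left hle (mul_nonneg (hQ x) (hV x y))).trans (le_of_eq ?_)
    have hs' : 0 < (V x y ^ (1 / (1 + ξ))) ^ ξ := Real.rpow_pos_of_pos hs _
    generalize hu : V x y ^ (1 / (1 + ξ)) = u at *
    generalize u ^ ξ = w at *
    rw [hsplit]
    field_simp
  refine (Finset.sum_le_sum fun x _ => hx x).trans (le_of_eq ?_)
  rw [← Finset.sum_mul, ← hb, add_comm 1 ξ, Real.rpow_add_one' hb0 (by positivity)]
  ring

/-- Random coding with list decoding: there is a codebook whose average probability of the sent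
message not being among the `L` most likely ones satisfies Gallager's bound. -/
theorem exists_codebook_error_le {M : ℕ} {A S : Type*} [Fintype A] [Fintype S] {Q : A → ℝ}
    (hQ : ∀ x, 0 ≤ Q x) (hQ1 : ∑ x, Q x = 1) {V : A → S → ℝ} (hV : ∀ x y, 0 ≤ V x y)
    {L : ℕ} {ξ : ℝ} (hξ : 0 < ξ) (hL : ξ ≤ L) :
    ∃ c : Fin M → A, (M : ℝ)⁻¹ * ∑ m, ∑ y, V (c m) y *
        (if m ∉ likelyList L (fun m' => V (c m') y) then 1 else 0) ≤
      (M : ℝ) ^ ξ * ∑ y, (∑ x, Q x * V x y ^ (1 / (1 + ξ))) ^ (1 + ξ) := by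
  by_contra! hcon
  set B := (M : ℝ) ^ ξ * ∑ y, (∑ x, Q x * V x y ^ (1 / (1 + ξ))) ^ (1 + ξ) with hB
  have hB0 : 0 ≤ B := mul_nonneg (by positivity) (Finset.sum_nonneg fun y _ => Real.rpow_nonneg
    (Finset.sum_nonneg fun x _ => mul_nonneg (hQ x) (Real.rpow_nonneg (hV x y) _)) _)
  set w : (Fin M → A) → ℝ := fun c => ∏ i, Q (c i)
  have hw0 : ∀ c, 0 ≤ w c := fun c => Finset.prod_nonneg fun i _ => hQ _
  have hw1 : ∑ c, w c = 1 := by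
    rw [← Fintype.prod_sum (fun _ x => Q x)]; simp [hQ1]
  set F : (Fin M → A) → ℝ := fun c => (M : ℝ)⁻¹ * ∑ m, ∑ y, V (c m) y *
        (if m ∉ likelyList L (fun m' => V (c m') y) then 1 else 0) with hF
  have havg : ∑ c, w c * F c ≤ B := by
    have : ∑ c, w c * F c = (M : ℝ)⁻¹ * ∑ m : Fin M, ∑ y, ∑ c, w c * (V (c m) y *
        (if m ∉ likelyList L (fun m' => V (c m') y) then 1 else 0)) := by
      simp only [hF, Finset.mul_sum]
      rw [Finset.sum_comm]
      refine Finset.sum_congr rfl fun m _ => ?_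
      rw [Finset.sum_comm]
      refine Finset.sum_congr rfl fun y _ => Finset.sum_congr rfl fun c _ => by ring
    rw [this]
    have hm : ∑ m : Fin M, ∑ y, ∑ c, w c * (V (c m) y *
        (if m ∉ likelyList L (fun m' => V (c m') y) then 1 else 0)) ≤ M * B := by
      have hmB : ∀ m ∈ (Finset.univ : Finset (Fin M)), ∑ y, ∑ c, w c * (V (c m) y *
          (if m ∉ likelyList L (fun m' => V (c m') y) then 1 else 0)) ≤ B := fun m _ => by
        rw [hB, Finset.mul_sum]
        exact Finset.sum_le_sum fun y _ => sum_codebook_error_le hQ hQ1 hV hξ hL m y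
      refine (Finset.sum_le_card_nsmul _ _ B hmB).trans (le_of_eq ?_)
      simp
    rcases Nat.eq_zero_or_pos M with h0 | hpos
    · simp [h0, hB0]
    · have : (0 : ℝ) < M := by exact_mod_cast hpos
      rw [inv_mul_le_iff₀ this]
      exact hm
  -- Strictness needs only one codebook of positive weight, which exists since the weights sum to
  -- one.
  have hlt : ∑ c, w c * B < ∑ c, w c * F c := by
    obtain ⟨c, -, hc⟩ := Finset.exists_ne_zero_of_sum_ne_zero (hw1.symm ▸ one_ne_zero)
    refine Finset.sum_lt_sum (fun c _ => mul_le_mul_of_nonneg_left (hcon c).le (hw0 c))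
      ⟨c, Finset.mem_univ c, mul_lt_mul_of_pos_left (hcon c) ((hw0 c).lt_of_ne' hc)⟩
  rw [← Finset.sum_mul, hw1, one_mul] at hlt
  exact absurd havg (not_le.2 hlt)

/-! ### Block codes over a memoryless channel and their concatenation through feedback. -/

namespace DMC

variable {X Y : Type*} [Fintype X] [Fintype Y]

/-- The quantity `exp (-E₀(ξ, P))`. -/
noncomputable def gallagerSum (W : DMC X Y) (ξ : ℝ) (P : X → ℝ) : ℝ :=
  ∑ y, (∑ x, P x * W.prob x y ^ (1 / (1 + ξ))) ^ (1 + ξ)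

/-- For i.i.d. codeword letters the Gallager sum of the product channel factors into `n`
single-letter sums. -/
theorem exists_blockEncoder_error_le (W : DMC X Y) {n M L : ℕ} {ξ : ℝ} (hξ : 0 < ξ) (hL : ξ ≤ L)
    (P : stdSimplex ℝ X) :
    ∃ f : BlockEncoder X n M, (M : ℝ)⁻¹ * ∑ m, ∑ y, W.blockProb f m y *
        (if m ∉ likelyList L (fun m' => W.blockProb f m' y) then 1 else 0) ≤
      (M : ℝ) ^ ξ * W.gallagerSum ξ P ^ n := by
  obtain ⟨c, hc⟩ := exists_codebook_error_le (M := M) (A := Fin n → X) (S := Fin n → Y)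
    (Q := fun x => ∏ i, P.1 (x i)) (V := fun x y => ∏ i, W.prob (x i) (y i))
    (fun x => Finset.prod_nonneg fun i _ => P.2.1 _)
    (by rw [← Fintype.prod_sum (fun _ x => P.1 x)]; simp [P.2.2])
    (fun x y => Finset.prod_nonneg fun i _ => W.nonneg _ _) hξ hL
  refine ⟨c, hc.trans (le_of_eq ?_)⟩
  congr 1
  have h : ∀ y : Fin n → Y, (∑ x : Fin n → X, (∏ i, P.1 (x i)) *
      (∏ i, W.prob (x i) (y i)) ^ (1 / (1 + ξ))) ^ (1 + ξ) =
      ∏ i, (∑ x, P.1 x * W.prob x (y i) ^ (1 / (1 + ξ))) ^ (1 + ξ) := by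
    intro y
    rw [Real.finsetProd_rpow _ _ fun i _ => Finset.sum_nonneg fun x _ =>
      mul_nonneg (P.2.1 x) (Real.rpow_nonneg (W.nonneg _ _) _),
      Fintype.prod_sum (fun i x => P.1 x * W.prob x (y i) ^ (1 / (1 + ξ)))]
    congr 1
    refine Finset.sum_congr rfl fun x _ => ?_
    rw [Finset.prod_mul_distrib, Real.finsetProd_rpow _ _ fun i _ => W.nonneg _ _]
  simp only [h]
  rw [← Fintype.prod_sum
    (fun (_ : Fin n) y => (∑ x, P.1 x * W.prob x y ^ (1 / (1 + ξ))) ^ (1 + ξ))]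
  simp [gallagerSum]
  rfl

theorem blockProb_nonneg (W : DMC X Y) {n M : ℕ} (f : BlockEncoder X n M) (m : Fin M)
    (y : Fin n → Y) : 0 ≤ W.blockProb f m y :=
  Finset.prod_nonneg fun _ _ => W.nonneg _ _

theorem sum_blockProb (W : DMC X Y) {n M : ℕ} (f : BlockEncoder X n M) (m : Fin M) :
    ∑ y, W.blockProb f m y = 1 := by
  unfold blockProb
  rw [← Fintype.prod_sum (fun i y => W.prob (f m i) y)]
  simp [W.sum_eq_one]

theorem blockProb_pos_iff (W : DMC X Y) {n M : ℕ} (f : BlockEncoder X n M) (m : Fin M)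
    (y : Fin n → Y) : 0 < W.blockProb f m y ↔ ∀ i, 0 < W.prob (f m i) (y i) := by
  refine ⟨fun h i => (W.nonneg _ _).lt_of_ne' fun h0 => h.ne' ?_, fun h => Finset.prod_pos fun i _ => h i⟩
  exact Finset.prod_eq_zero (Finset.mem_univ i) h0

/-- A block encoder followed by a block encoder that may depend on the outputs of the first one is
a feedback encoder. -/
theorem exists_feedbackEncoder_append (W : DMC X Y) {n N M : ℕ} (f : BlockEncoder X n M)
    (g : (Fin n → Y) → BlockEncoder X N M) :
    ∃ h : FeedbackEncoder X Y (n + N) M, ∀ m y z,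
      W.feedbackProb h m (Fin.append y z) = W.blockProb f m y * W.blockProb (g y) m z := by
  refine ⟨fun i m past => if hi : (i : ℕ) < n then f m ⟨i, hi⟩ else
    g (fun j => past ⟨j, by have := j.2; omega⟩) m ⟨i - n, by have := i.2; omega⟩, ?_⟩
  intro m y z
  unfold feedbackProb blockProb
  rw [Fin.prod_univ_add]
  congr 1
  · refine Finset.prod_congr rfl fun i _ => ?_
    simp
  · refine Finset.prod_congr rfl fun i _ => ?_
    have : ∀ j : Fin n, Fin.append y z (Fin.castLE (Fin.natAdd n i).isLt.le
        ⟨j, by have := j.2; simp; omega⟩) = y j := fun j => Fin.append_left y z j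
    simp only [this, Fin.append_right]
    simp

/-- The probability that a memoryless channel avoids a set of outputs at every time in `J`. -/
theorem sum_blockProb_avoid_le [DecidableEq Y] (W : DMC X Y) {N M : ℕ} (g : BlockEncoder X N M) (m : Fin M)
    (J : Finset (Fin N)) (Y₀ : Finset Y) {x₁ : X} (hJ : ∀ j ∈ J, g m j = x₁) {d : ℕ}
    (hd : d ≤ J.card) {t : ℝ} (ht : 1 - ∑ y ∈ Y₀, W.prob x₁ y ≤ t) (ht1 : t ≤ 1) :
    ∑ z, W.blockProb g m z * (if ∀ j ∈ J, z j ∉ Y₀ then 1 else 0) ≤ t ^ d := by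
  have hsplit : 1 - ∑ y ∈ Y₀, W.prob x₁ y = ∑ y, W.prob x₁ y * (if y ∈ Y₀ then 0 else 1) := by
    have h := Finset.sum_filter_add_sum_filter_not Finset.univ (· ∈ Y₀) (W.prob x₁)
    rw [W.sum_eq_one, Finset.filter_univ_mem, Finset.sum_filter] at h
    rw [sub_eq_iff_eq_add', ← h]
    congr 1
    exact Finset.sum_congr rfl fun y _ => by split_ifs <;> simp_all
  have h0 : 0 ≤ 1 - ∑ y ∈ Y₀, W.prob x₁ y := by
    rw [hsplit]
    exact Finset.sum_nonneg fun y _ => mul_nonneg (W.nonneg _ _) (by split_ifs <;> norm_num)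
  have hprod : ∀ z : Fin N → Y, W.blockProb g m z * (if ∀ j ∈ J, z j ∉ Y₀ then (1 : ℝ) else 0) =
      ∏ j, W.prob (g m j) (z j) * (if j ∈ J then (if z j ∈ Y₀ then 0 else 1) else 1) := by
    intro z
    rw [Finset.prod_mul_distrib, blockProb]
    congr 1
    split_ifs with h
    · refine (Finset.prod_eq_one fun j _ => ?_).symm
      by_cases hj : j ∈ J
      · simp [hj, h j hj]
      · simp [hj]
    · push Not at h
      obtain ⟨j, hj, hz⟩ := h
      exact (Finset.prod_eq_zero (Finset.mem_univ j) (by simp [hj, hz])).symm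
  simp only [hprod]
  rw [← Fintype.prod_sum (fun j y => W.prob (g m j) y *
    (if j ∈ J then (if y ∈ Y₀ then (0 : ℝ) else 1) else 1))]
  have hj : ∀ j, ∑ y, W.prob (g m j) y * (if j ∈ J then (if y ∈ Y₀ then (0 : ℝ) else 1) else 1) =
      if j ∈ J then 1 - ∑ y ∈ Y₀, W.prob x₁ y else 1 := by
    intro j
    by_cases h : j ∈ J
    · simp only [h, if_true, hJ j h, hsplit]
    · simp only [h, if_false, mul_one, W.sum_eq_one]
  simp only [hj]
  rw [Finset.prod_ite_mem, Finset.univ_inter, Finset.prod_const]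
  exact (pow_le_pow_left₀ h0 ht _).trans (pow_le_pow_of_le_one (h0.trans ht) ht1 hd)

end DMC

/-! ### The two-stage code at finite blocklength. -/

/-- The message sent is always on the list. This is the lower half of the squeeze to the limit one.
-/
theorem one_le_listMoment {M : ℕ} {S : Type*} [Fintype S] {ρ : ℝ} (hρ : 0 < ρ) (hM : 0 < M)
    {p : Fin M → S → ℝ} (hp : ∀ m y, 0 ≤ p m y) (hp1 : ∀ m, ∑ y, p m y = 1) :
    1 ≤ listMoment ρ p := by
  have hM' : (0 : ℝ) < M := by exact_mod_cast hM
  have h : ∀ m ∈ (Finset.univ : Finset (Fin M)),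
      1 ≤ ∑ y, p m y * ((messageList p y).card : ℝ) ^ ρ := by
    intro m _
    rw [← hp1 m]
    refine Finset.sum_le_sum fun y _ => ?_
    rcases (hp m y).eq_or_lt with h0 | hpos
    · simp [← h0]
    · refine le_mul_of_one_le_right (hp m y) (Real.one_le_rpow ?_ hρ.le)
      have : 0 < (messageList p y).card :=
        Finset.card_pos.2 ⟨m, Finset.mem_filter.2 ⟨Finset.mem_univ m, hpos⟩⟩
      exact_mod_cast this
  have := Finset.card_nsmul_le_sum _ _ _ h
  rw [listMoment, le_inv_mul_iff₀ hM']
  simpa using this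

theorem exists_injOn_fin {α : Type*} (S : Finset α) {L : ℕ} (hS : S.card ≤ L) (hL : 0 < L) :
    ∃ e : α → Fin L, Set.InjOn e S := by
  classical
  refine ⟨fun a => if h : a ∈ S then Fin.castLE hS (S.equivFin ⟨a, h⟩) else ⟨0, hL⟩, ?_⟩
  intro a ha b hb hab
  simpa [Finset.mem_coe.1 ha, Finset.mem_coe.1 hb] using hab

/-- A schedule of `d + L * k` times: `d` of them are labelled `none`, and for each `a : Fin L`, `k`
of them are labelled `some a`. -/
theorem exists_schedule (d L k : ℕ) : ∃ τ : Fin (d + L * k) → Option (Fin L),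
    d ≤ (Finset.univ.filter fun j => τ j = none).card ∧
    ∀ a, k ≤ (Finset.univ.filter fun j => τ j = some a).card := by
  refine ⟨fun j => Sum.elim (fun _ => none) (fun p => some (finProdFinEquiv.symm p).1)
    (finSumFinEquiv.symm j), ?_, fun a => ?_⟩
  · have := Finset.card_le_card_of_injOn (s := (Finset.univ : Finset (Fin d)))
      (t := Finset.univ.filter fun j : Fin (d + L * k) =>
        Sum.elim (fun _ => none) (fun p => some (finProdFinEquiv.symm p).1)
          (finSumFinEquiv.symm j) = (none : Option (Fin L)))
      (fun i => finSumFinEquiv (Sum.inl i)) (fun i _ => by simp)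
      (fun i _ j _ h => by simpa using h)
    simpa using this
  · have := Finset.card_le_card_of_injOn (s := (Finset.univ : Finset (Fin k)))
      (t := Finset.univ.filter fun j : Fin (d + L * k) =>
        Sum.elim (fun _ => none) (fun p => some (finProdFinEquiv.symm p).1)
          (finSumFinEquiv.symm j) = some a)
      (fun i => finSumFinEquiv (Sum.inr (finProdFinEquiv (a, i))))
      (fun i _ => by
        simp only [Finset.coe_filter, Finset.mem_univ, true_and, Set.mem_ofPred_eq,
          Equiv.symm_apply_apply, Sum.elim_inr])
      (fun i _ j _ h => by
        have := finProdFinEquiv.injective (Sum.inr_injective (finSumFinEquiv.injective h))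
        exact (Prod.mk.inj this).2)
    simpa using this

namespace DMC

variable {X Y : Type*} [Fintype X] [Fintype Y]

/-- Two-stage feedback code. In the first stage a random block code narrows the messages down to a
list of `L` candidates. In the second stage the encoder confirms, by sending `x₁` rather than `x₀`,
that the message is on that list (`d` times) and which candidate it is (`k` times each). An
output in `Y₀`, which `x₀` cannot produce, is a proof of such a claim. -/
theorem exists_feedbackEncoder_listMoment_le (W : DMC X Y) {ρ ξ : ℝ} (hρ : 0 < ρ) (hξ : 0 < ξ)
    {n d k L M : ℕ} (hL : ξ ≤ L) (hM : 0 < M) (P : stdSimplex ℝ X) {x₀ x₁ : X} {Y₀ : Finset Y}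
    (hx₀ : ∑ y ∈ Y₀, W.prob x₀ y = 0) {t : ℝ} (ht : 1 - ∑ y ∈ Y₀, W.prob x₁ y ≤ t) (ht1 : t ≤ 1) :
    ∃ h : FeedbackEncoder X Y (n + (d + L * k)) M, 1 ≤ listMoment ρ (W.feedbackProb h) ∧
      listMoment ρ (W.feedbackProb h) ≤ 1 + (M : ℝ) ^ ρ * ((M : ℝ) ^ ξ * W.gallagerSum ξ P ^ n) +
        (M : ℝ) ^ ρ * t ^ d + (L : ℝ) ^ ρ * t ^ k := by
  classical
  have hM' : (0 : ℝ) < M := by exact_mod_cast hM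
  have hL0 : 0 < L := by
    have : (0 : ℝ) < L := hξ.trans_le hL
    exact_mod_cast this
  have hx₀' : ∀ y ∈ Y₀, W.prob x₀ y = 0 :=
    (Finset.sum_eq_zero_iff_of_nonneg fun y _ => W.nonneg x₀ y).1 hx₀
  obtain ⟨f, hf⟩ := W.exists_blockEncoder_error_le (n := n) (M := M) hξ hL P
  obtain ⟨τ, hτd, hτk⟩ := exists_schedule d L k
  set ℓ : (Fin n → Y) → Finset (Fin M) := fun y => likelyList L (fun m' => W.blockProb f m' y)
    with hℓ
  -- `e y` labels the candidates of the list after `y` injectively by `Fin L`.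
  choose e he using fun y => exists_injOn_fin (ℓ y) (card_likelyList_le L _) hL0
  -- `D y j` is the set of messages for which the claim tested at time `j` is true: being on the
  -- list, or being the candidate with label `a`.
  let D : (Fin n → Y) → Fin (d + L * k) → Finset (Fin M) := fun y j =>
    (τ j).elim (ℓ y) (fun a => (ℓ y).filter fun m => e y m = a)
  let g : (Fin n → Y) → BlockEncoder X (d + L * k) M := fun y m j => if m ∈ D y j then x₁ else x₀
  obtain ⟨h, hh⟩ := W.exists_feedbackEncoder_append f g
  have hsum : ∀ (F : (Fin (n + (d + L * k)) → Y) → ℝ),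
      ∑ y, F y = ∑ y, ∑ z, F (Fin.append y z) := by
    intro F
    rw [← (Fin.appendEquiv n (d + L * k)).sum_comp, Fintype.sum_prod_type]
    rfl
  have hnn : ∀ m y, 0 ≤ W.feedbackProb h m y := fun m y => Finset.prod_nonneg fun _ _ => W.nonneg _ _
  have hone : ∀ m, ∑ y, W.feedbackProb h m y = 1 := by
    intro m
    simp only [hsum, hh, ← Finset.mul_sum, sum_blockProb, mul_one]
  refine ⟨h, one_le_listMoment hρ hM hnn hone, ?_⟩
  -- A message outside `D y j` sends `x₀` at time `j` and so cannot produce an output in `Y₀`.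
  have hconfirm : ∀ y z j, z j ∈ Y₀ →
      messageList (W.feedbackProb h) (Fin.append y z) ⊆ D y j := by
    intro y z j hz m hm
    have hpos := (Finset.mem_filter.1 hm).2
    rw [hh] at hpos
    have hgpos : 0 < W.blockProb (g y) m z :=
      (pos_iff_pos_of_mul_pos hpos).1 ((W.blockProb_nonneg _ _ _).lt_of_ne' (left_ne_zero_of_mul hpos.ne'))
    by_contra hmD
    have := (W.blockProb_pos_iff _ _ _).1 hgpos j
    simp only [g, hmD, if_false, hx₀' _ hz, lt_irrefl] at this
  have hcardM : ∀ s : Finset (Fin M), (s.card : ℝ) ^ ρ ≤ (M : ℝ) ^ ρ := by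
    intro s
    refine Real.rpow_le_rpow (Nat.cast_nonneg _) ?_ hρ.le
    have := Finset.card_le_univ s
    rw [Fintype.card_fin] at this
    exact_mod_cast this
  have hLρ : 0 ≤ (L : ℝ) ^ ρ := by positivity
  have hMρ : 0 ≤ (M : ℝ) ^ ρ := by positivity
  -- The list has at most `M` messages if list membership is not proved, at most `L` if it is, and
  -- at most one if the candidate is proved.
  have hpoint : ∀ m y z, m ∈ ℓ y →
      ((messageList (W.feedbackProb h) (Fin.append y z)).card : ℝ) ^ ρ ≤ 1 +
        (M : ℝ) ^ ρ * (if ∀ j ∈ Finset.univ.filter (fun j => τ j = none), z j ∉ Y₀ then 1 else 0) +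
        (L : ℝ) ^ ρ * (if ∀ j ∈ Finset.univ.filter (fun j => τ j = some (e y m)), z j ∉ Y₀
          then 1 else 0) := by
    intro m y z hm
    split_ifs with h1 h2 h2
    · linarith [hcardM (messageList (W.feedbackProb h) (Fin.append y z))]
    · linarith [hcardM (messageList (W.feedbackProb h) (Fin.append y z))]
    · push Not at h1
      obtain ⟨j, hj, hz⟩ := h1
      have hsub := hconfirm y z j hz
      have hD : D y j = ℓ y := by simp only [D, (Finset.mem_filter.1 hj).2, Option.elim]
      rw [hD] at hsub
      have hc : (messageList (W.feedbackProb h) (Fin.append y z)).card ≤ L :=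
        (Finset.card_le_card hsub).trans (card_likelyList_le L _)
      have : ((messageList (W.feedbackProb h) (Fin.append y z)).card : ℝ) ^ ρ ≤ (L : ℝ) ^ ρ :=
        Real.rpow_le_rpow (Nat.cast_nonneg _) (by exact_mod_cast hc) hρ.le
      linarith
    · push Not at h2
      obtain ⟨j, hj, hz⟩ := h2
      have hsub := hconfirm y z j hz
      have hD : D y j = (ℓ y).filter fun m' => e y m' = e y m := by
        simp only [D, (Finset.mem_filter.1 hj).2, Option.elim]
      rw [hD] at hsub
      have hc : (messageList (W.feedbackProb h) (Fin.append y z)).card ≤ 1 := by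
        refine (Finset.card_le_card hsub).trans (Finset.card_le_one.2 fun a ha b hb => ?_)
        rw [Finset.mem_filter] at ha hb
        exact he y ha.1 hb.1 (ha.2.trans hb.2.symm)
      have : ((messageList (W.feedbackProb h) (Fin.append y z)).card : ℝ) ^ ρ ≤ 1 :=
        Real.rpow_le_one (Nat.cast_nonneg _) (by exact_mod_cast hc) hρ.le
      linarith
  set B := 1 + (M : ℝ) ^ ρ * t ^ d + (L : ℝ) ^ ρ * t ^ k with hB
  have ht0 : 0 ≤ t := by
    refine le_trans (sub_nonneg.2 ?_) ht
    rw [← W.sum_eq_one x₁]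
    exact Finset.sum_le_sum_of_subset_of_nonneg (Finset.subset_univ _) fun y _ _ => W.nonneg _ _
  have hB0 : 0 ≤ B := by positivity
  have hinner : ∀ m y, ∑ z, W.blockProb (g y) m z *
      ((messageList (W.feedbackProb h) (Fin.append y z)).card : ℝ) ^ ρ ≤
      B + (M : ℝ) ^ ρ * (if m ∉ ℓ y then 1 else 0) := by
    intro m y
    by_cases hm : m ∈ ℓ y
    · simp only [hm, not_true_eq_false, if_false, mul_zero, add_zero]
      refine (Finset.sum_le_sum fun z _ => mul_le_mul_of_nonneg_left (hpoint m y z hm)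
        (W.blockProb_nonneg _ _ _)).trans ?_
      simp only [mul_add, mul_one, Finset.sum_add_distrib, sum_blockProb, mul_left_comm _ (_ ^ ρ),
        ← Finset.mul_sum, hB]
      gcongr
      · refine W.sum_blockProb_avoid_le (g y) m _ Y₀ (x₁ := x₁) (fun j hj => ?_) hτd ht ht1
        simp only [g, D, (Finset.mem_filter.1 hj).2, Option.elim, hm, if_true]
      · refine W.sum_blockProb_avoid_le (g y) m _ Y₀ (x₁ := x₁) (fun j hj => ?_) (hτk _) ht ht1
        simp only [g, D, (Finset.mem_filter.1 hj).2, Option.elim, Finset.mem_filter, hm, and_self,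
          if_true]
    · simp only [hm, not_false_eq_true, if_true, mul_one]
      have : ∑ z, W.blockProb (g y) m z *
          ((messageList (W.feedbackProb h) (Fin.append y z)).card : ℝ) ^ ρ ≤ (M : ℝ) ^ ρ := by
        refine (Finset.sum_le_sum fun z _ => mul_le_mul_of_nonneg_left (hcardM _)
          (W.blockProb_nonneg _ _ _)).trans (le_of_eq ?_)
        rw [← Finset.sum_mul, sum_blockProb, one_mul]
      linarith
  have hmoment : listMoment ρ (W.feedbackProb h) ≤ (M : ℝ)⁻¹ * ∑ m : Fin M, (B + (M : ℝ) ^ ρ *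
      ∑ y, W.blockProb f m y * (if m ∉ ℓ y then 1 else 0)) := by
    refine mul_le_mul_of_nonneg_left (Finset.sum_le_sum fun m _ => ?_) (inv_nonneg.2 hM'.le)
    rw [hsum]
    simp only [hh, mul_assoc, ← Finset.mul_sum]
    refine (Finset.sum_le_sum fun y _ => mul_le_mul_of_nonneg_left (hinner m y)
      (W.blockProb_nonneg _ _ _)).trans (le_of_eq ?_)
    simp only [mul_add, Finset.sum_add_distrib, ← Finset.sum_mul, sum_blockProb, one_mul,
      mul_left_comm _ ((M : ℝ) ^ ρ), ← Finset.mul_sum]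
  refine hmoment.trans ?_
  rw [Finset.sum_add_distrib, mul_add, ← Finset.mul_sum, mul_left_comm]
  have h1 : (M : ℝ)⁻¹ * ∑ _m : Fin M, B = B := by
    simp [hM'.ne']
  rw [h1]
  have := mul_le_mul_of_nonneg_left hf hMρ
  simp only [hB]
  linarith

/-! ### Consequences of positive capacities for `q⋆`. -/

/-- Two codewords of a zero-error code have disjoint output supports at some coordinate: otherwise
common outputs, chosen coordinate by coordinate, form a sequence that both can produce. Take for
`Y₀` the support of one of the two letters. -/
theorem qstar_eq_one_of_zeroErrorCapacity_pos (W : DMC X Y) (h : 0 < W.zeroErrorCapacity) :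
    W.qstar = 1 := by
  classical
  obtain ⟨c, ⟨n, M, hn, hM, ⟨f, hf⟩, rfl⟩, hc⟩ := lt_sSup_iff.1 h
  have hc' : 0 < Real.log M / n := by exact_mod_cast hc
  have hM1 : 1 < M := by
    by_contra hle
    have : M = 1 := by omega
    simp [this] at hc'
  obtain ⟨i, hi⟩ : ∃ i, ∀ y, ¬ (0 < W.prob (f ⟨0, hM⟩ i) y ∧ 0 < W.prob (f ⟨1, hM1⟩ i) y) := by
    by_contra! hcon
    choose y hy using hcon
    have := hf y ⟨0, hM⟩ ⟨1, hM1⟩ ((W.blockProb_pos_iff _ _ _).2 fun i => (hy i).1)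
      ((W.blockProb_pos_iff _ _ _).2 fun i => (hy i).2)
    simp at this
  have : Nonempty X := ⟨f ⟨0, hM⟩ i⟩
  obtain ⟨⟨x₁, x₀, Y₀, -, hq⟩, hub⟩ := W.qstar_isGreatest
  refine le_antisymm ?_ (hub ⟨f ⟨1, hM1⟩ i, f ⟨0, hM⟩ i,
    Finset.univ.filter fun y => 0 < W.prob (f ⟨1, hM1⟩ i) y, ?_, ?_⟩)
  · rw [hq, ← W.sum_eq_one x₁]
    exact Finset.sum_le_sum_of_subset_of_nonneg (Finset.subset_univ _) fun y _ _ => W.nonneg _ _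
  · refine Finset.sum_eq_zero fun y hy => ?_
    by_contra hne
    exact hi y ⟨(W.nonneg _ _).lt_of_ne' hne, (Finset.mem_filter.1 hy).2⟩
  · rw [← W.sum_eq_one (f ⟨1, hM1⟩ i), Finset.sum_filter]
    refine Finset.sum_congr rfl fun y _ => ?_
    split_ifs with hy
    · rfl
    · exact le_antisymm (not_lt.1 hy) (W.nonneg _ _)

/-- If every input can produce the same outputs, then every list contains all the messages, so
that the listsize capacity is not positive. -/
theorem qstar_pos_of_listCapacity_pos (W : DMC X Y) {ρ : ℝ} (hρ : 0 < ρ)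
    (h : 0 < W.listCapacity ρ) : Nonempty X ∧ 0 < W.qstar := by
  classical
  obtain ⟨c, ⟨R, rfl, f, hf⟩, hR⟩ := lt_sSup_iff.1 h
  have hR : 0 < R := by exact_mod_cast hR
  have hM : ∀ᶠ n : ℕ in atTop, 2 ≤ numMessages n R := by
    have : Tendsto (fun n : ℕ => Real.exp (n * R)) atTop atTop :=
      Real.tendsto_exp_atTop.comp (tendsto_natCast_atTop_atTop.atTop_mul_const hR)
    filter_upwards [this.eventually_ge_atTop 2] with n hn
    exact Nat.le_floor (by exact_mod_cast hn)
  obtain ⟨n₀, hn₀, hn₀'⟩ := (hM.and (eventually_ge_atTop 1)).exists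
  have hX : Nonempty X := ⟨f n₀ ⟨0, by omega⟩ ⟨0, by omega⟩⟩
  refine ⟨hX, lt_of_not_ge fun hq => ?_⟩
  -- An output possible under `x` but not under `x'` would, as a singleton `Y₀`, make `q⋆` positive.
  have hsupp : ∀ x x' y, 0 < W.prob x y → 0 < W.prob x' y := by
    intro x x' y hx
    by_contra hx'
    have h0 : W.prob x' y = 0 := le_antisymm (not_lt.1 hx') (W.nonneg _ _)
    have := W.qstar_isGreatest.2 ⟨x, x', {y}, by simp [h0], by simp; rfl⟩
    linarith
  have hge : ∀ᶠ n : ℕ in atTop, (2 : ℝ) ^ ρ ≤ listMoment ρ (W.blockProb (f n)) := by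
    filter_upwards [hM] with n hn
    have hM0 : (0 : ℝ) < numMessages n R := by exact_mod_cast (by omega : 0 < numMessages n R)
    have hm : ∀ m ∈ (Finset.univ : Finset (Fin (numMessages n R))), (2 : ℝ) ^ ρ ≤
        ∑ y, W.blockProb (f n) m y * ((messageList (W.blockProb (f n)) y).card : ℝ) ^ ρ := by
      intro m _
      rw [← one_mul ((2 : ℝ) ^ ρ), ← W.sum_blockProb (f n) m, Finset.sum_mul]
      refine Finset.sum_le_sum fun y _ => ?_
      rcases (W.blockProb_nonneg (f n) m y).eq_or_lt with h0 | hpos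
      · simp [← h0]
      refine mul_le_mul_of_nonneg_left ?_ hpos.le
      have hall : messageList (W.blockProb (f n)) y = Finset.univ := by
        refine Finset.filter_true_of_mem fun m' _ => (W.blockProb_pos_iff _ _ _).2 fun i => ?_
        exact hsupp _ _ _ ((W.blockProb_pos_iff _ _ _).1 hpos i)
      rw [hall, Finset.card_univ, Fintype.card_fin]
      exact Real.rpow_le_rpow (by norm_num) (by exact_mod_cast hn) hρ.le
    have := Finset.card_nsmul_le_sum _ _ _ hm
    rw [listMoment, le_inv_mul_iff₀ hM0]
    simpa using this
  have := ge_of_tendsto hf hge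
  have h2 : (1 : ℝ) < 2 ^ ρ := Real.one_lt_rpow (by norm_num) hρ
  linarith

/-! ### Asymptotics of the two-stage code. -/

theorem gallagerSum_eq_exp (W : DMC X Y) {ξ : ℝ} (hξ : 0 < ξ) (P : stdSimplex ℝ X) :
    W.gallagerSum ξ P = Real.exp (-W.E0 ξ P) := by
  obtain ⟨hY, h⟩ := W.E0_sum_lower hξ P
  have hpos : 0 < W.gallagerSum ξ P := (Real.rpow_pos_of_pos hY _).trans_le h
  unfold E0
  rw [neg_neg]
  exact (Real.exp_log hpos).symm

theorem tendsto_exp_natCast_mul_add {a : ℝ} (ha : a < 0) (b : ℝ) :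
    Tendsto (fun n : ℕ => Real.exp (n * a + b)) atTop (𝓝 0) :=
  Real.tendsto_exp_atBot.comp
    (tendsto_atBot_add_const_right _ b (tendsto_natCast_atTop_atTop.atTop_mul_const_of_neg ha))

/-- Splitting the blocklength between the two stages in proportions `α` and `β` (up to a small
remainder) makes the listsize moment of the two-stage code tend to one. -/
theorem exists_feedbackEncoder_tendsto (W : DMC X Y) {ρ ξ R r l : ℝ} (hρ : 0 < ρ) (hξ : 0 < ξ)
    (hR : 0 < R) (hr : 0 < r) (hl : 0 < l) (P : stdSimplex ℝ X) (hE : W.E0 ξ P = r * (ξ + ρ))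
    {x₀ x₁ : X} {Y₀ : Finset Y} (hx₀ : ∑ y ∈ Y₀, W.prob x₀ y = 0)
    (ht : 1 - ∑ y ∈ Y₀, W.prob x₁ y ≤ Real.exp (-l)) (hlt : R / r + ρ * R / l < 1) :
    ∃ f : (n : ℕ) → FeedbackEncoder X Y n (numMessages n R),
      Tendsto (fun n => listMoment ρ (W.feedbackProb (f n))) atTop (𝓝 1) := by
  -- The hypothesis `hlt` leaves room for `α > R / r` and `β > ρ * R / l` with `α + β < 1`.
  obtain ⟨α, hα, hα'⟩ := exists_between (lt_sub_iff_add_lt.2 hlt)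
  obtain ⟨β, hβ, hβ'⟩ := exists_between (lt_sub_comm.1 hα')
  have hα0 : 0 < α := (div_pos hR hr).trans hα
  have hβ0 : 0 < β := (div_pos (mul_pos hρ hR) hl).trans hβ
  rw [div_lt_iff₀ hr] at hα
  rw [div_lt_iff₀ hl] at hβ
  obtain ⟨L, hL⟩ := exists_nat_ge ξ
  have hL0 : (0 : ℝ) < L := hξ.trans_le hL
  -- The `L` candidate tests use half of the spare time; the other half absorbs the rounding up of
  -- `n * β`, once `n * (L * γ) ≥ 1`.
  set γ := (1 - α - β) / (2 * L) with hγ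
  have hγ0 : 0 < γ := div_pos (by linarith) (by positivity)
  have hLγ : L * γ = (1 - α - β) / 2 := by rw [hγ]; field_simp
  -- The three exponentials bound first-stage failure, an unproved list and an unproved candidate.
  -- The summand `l` in the last one pays for rounding `n * γ` down.
  set u : ℕ → ℝ := fun n => 1 + Real.exp (n * ((ρ + ξ) * (R - α * r)) + 0) +
    Real.exp (n * (ρ * R - β * l) + 0) + (L : ℝ) ^ ρ * Real.exp (n * (-(l * γ)) + l) with hu
  have hlim : Tendsto u atTop (𝓝 1) := by
    have h1 := tendsto_exp_natCast_mul_add (a := (ρ + ξ) * (R - α * r))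
      (mul_neg_of_pos_of_neg (by linarith) (by linarith)) 0
    have h2 := tendsto_exp_natCast_mul_add (a := ρ * R - β * l) (by linarith) 0
    have h3 := (tendsto_exp_natCast_mul_add (a := -(l * γ)) (by nlinarith) l).const_mul
      ((L : ℝ) ^ ρ)
    have h123 := ((h1.const_add 1).add h2).add h3
    rwa [add_zero, add_zero, mul_zero, add_zero] at h123
  have hex : ∀ n : ℕ, ∃ f : FeedbackEncoder X Y n (numMessages n R), 1 ≤ n * (L * γ) →
      1 ≤ listMoment ρ (W.feedbackProb f) ∧ listMoment ρ (W.feedbackProb f) ≤ u n := by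
    intro n
    by_cases hn : 1 ≤ n * (L * γ)
    swap
    · exact ⟨fun _ _ _ => x₀, fun h => absurd h hn⟩
    have hn0 : (0 : ℝ) ≤ n := Nat.cast_nonneg n
    obtain ⟨d, hd⟩ : ∃ d, d = ⌈n * β⌉₊ := ⟨_, rfl⟩
    obtain ⟨k, hk⟩ : ∃ k, k = ⌊n * γ⌋₊ := ⟨_, rfl⟩
    have hd1 : n * β ≤ d := hd ▸ Nat.le_ceil _
    have hd2 : (d : ℝ) < n * β + 1 := hd ▸ Nat.ceil_lt_add_one (by positivity)
    have hk1 : n * γ < k + 1 := hk ▸ Nat.lt_floor_add_one _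
    have hk2 : (k : ℝ) ≤ n * γ := hk ▸ Nat.floor_le (by positivity)
    have hk3 : (L : ℝ) * k ≤ n * (L * γ) := by
      have := mul_le_mul_of_nonneg_left hk2 hL0.le
      linarith
    have hle : n * α ≤ (n : ℝ) - (d + L * k) := by
      rw [hLγ] at hn hk3
      linarith
    have hdk : d + L * k ≤ n := by
      have : (d : ℝ) + L * k ≤ n := by
        have := mul_nonneg hn0 hα0.le
        linarith
      exact_mod_cast this
    obtain ⟨n₁, rfl⟩ := Nat.exists_eq_add_of_le' hdk
    have hn₁ : ((n₁ + (d + L * k) : ℕ) : ℝ) * α ≤ n₁ := by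
      push_cast at hle ⊢
      linarith
    generalize hN : n₁ + (d + L * k) = N at *
    subst hN
    set N := n₁ + (d + L * k) with hN
    have hNR : 0 ≤ (N : ℝ) * R := mul_nonneg hn0 hR.le
    have hM : 0 < numMessages N R := Nat.floor_pos.2 (Real.one_le_exp hNR)
    have hMle : (numMessages N R : ℝ) ≤ Real.exp (N * R) := Nat.floor_le (Real.exp_pos _).le
    obtain ⟨f, hf1, hf2⟩ := W.exists_feedbackEncoder_listMoment_le (n := n₁) (d := d) (k := k)
      hρ hξ hL hM P hx₀ ht (Real.exp_le_one_iff.2 (by linarith))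
    refine ⟨f, fun _ => ⟨hf1, hf2.trans ?_⟩⟩
    have hpow : ∀ s : ℝ, 0 ≤ s → (numMessages N R : ℝ) ^ s ≤ Real.exp (N * R * s) := by
      intro s hs
      rw [Real.exp_mul]
      exact Real.rpow_le_rpow (Nat.cast_nonneg _) hMle hs
    have hMρ := hpow ρ hρ.le
    have hMξ := hpow ξ hξ.le
    have hG : W.gallagerSum ξ P ^ n₁ ≤ Real.exp (-(r * (ξ + ρ)) * (N * α)) := by
      rw [W.gallagerSum_eq_exp hξ, hE, ← Real.exp_nat_mul, Real.exp_le_exp]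
      have := mul_le_mul_of_nonneg_left hn₁ (mul_nonneg hr.le (by linarith : 0 ≤ ξ + ρ))
      linarith
    have hG0 : 0 ≤ W.gallagerSum ξ P ^ n₁ := by
      rw [W.gallagerSum_eq_exp hξ]
      positivity
    have h1 : (numMessages N R : ℝ) ^ ρ * ((numMessages N R : ℝ) ^ ξ * W.gallagerSum ξ P ^ n₁) ≤
        Real.exp (N * ((ρ + ξ) * (R - α * r)) + 0) := by
      calc _ ≤ Real.exp (N * R * ρ) *
            (Real.exp (N * R * ξ) * Real.exp (-(r * (ξ + ρ)) * (N * α))) := by gcongr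
        _ = _ := by
          rw [← Real.exp_add, ← Real.exp_add]
          ring_nf
    have h2 : (numMessages N R : ℝ) ^ ρ * Real.exp (-l) ^ d ≤
        Real.exp (N * (ρ * R - β * l) + 0) := by
      rw [← Real.exp_nat_mul]
      refine (mul_le_mul_of_nonneg_right hMρ (Real.exp_pos _).le).trans ?_
      rw [← Real.exp_add, Real.exp_le_exp]
      have := mul_le_mul_of_nonneg_right hd1 hl.le
      linarith
    have h3 : Real.exp (-l) ^ k ≤ Real.exp (N * (-(l * γ)) + l) := by
      rw [← Real.exp_nat_mul, Real.exp_le_exp]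
      have := mul_le_mul_of_nonneg_right hk1.le hl.le
      linarith
    have h3' := mul_le_mul_of_nonneg_left h3 (Real.rpow_nonneg hL0.le ρ)
    simp only [hu]
    linarith
  choose f hf using hex
  have hev : ∀ᶠ n : ℕ in atTop, 1 ≤ (n : ℝ) * (L * γ) :=
    (tendsto_natCast_atTop_atTop.atTop_mul_const (mul_pos hL0 hγ0)).eventually_ge_atTop 1
  exact ⟨f, tendsto_of_tendsto_of_tendsto_of_le_of_le' tendsto_const_nhds hlim
    (hev.mono fun n hn => (hf n hn).1) (hev.mono fun n hn => (hf n hn).2)⟩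

/-! ### Properties of `R⋆` and the proof of the theorem. -/

theorem exists_E0_div_gt (W : DMC X Y) [Nonempty X] {ρ s : ℝ} (hρ : 0 < ρ) (hs : s < W.Rstar ρ) :
    ∃ ξ : ℝ, 0 < ξ ∧ ∃ P : stdSimplex ℝ X, s < W.E0 ξ P / (ξ + ρ) := by
  obtain ⟨_, ⟨⟨ξ, hξ⟩, rfl⟩, h, -⟩ := (W.Rstar_isLUB hρ).exists_between hs
  obtain ⟨P, hP⟩ := (W.E0_max_attained hξ ρ).1
  exact ⟨ξ, hξ, P, h.trans_eq hP.symm⟩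

/-- A point mass has `E₀ = 0`. -/
theorem Rstar_nonneg (W : DMC X Y) [Nonempty X] {ρ : ℝ} (hρ : 0 < ρ) : 0 ≤ W.Rstar ρ := by
  classical
  let x := Classical.arbitrary X
  have hE : W.E0 1 (stdSimplex.vertex (S := ℝ) x) = 0 := by
    have h : ∀ y, ∑ x', (stdSimplex.vertex (S := ℝ) x) x' * W.prob x' y ^ (1 / (1 + 1 : ℝ)) =
        W.prob x y ^ (1 / (1 + 1 : ℝ)) := by
      intro y
      rw [Finset.sum_eq_single x (fun x' _ hne => ?_) (by simp)]
      · simp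
      · simp [hne]
    unfold E0
    simp only [h, ← Real.rpow_mul (W.nonneg _ _)]
    norm_num [W.sum_eq_one]
  refine le_trans ?_ ((W.Rstar_isLUB hρ).1 ⟨⟨1, Set.mem_Ioi.2 zero_lt_one⟩, rfl⟩)
  exact (W.E0_max_attained zero_lt_one ρ).2 ⟨stdSimplex.vertex x, by
    change W.E0 1 (stdSimplex.vertex (S := ℝ) x) / (1 + ρ) = 0
    rw [hE, zero_div]⟩

/-- At rate zero there is a single message, and the moment equals one. -/
theorem listCapacityFeedback_nonneg (W : DMC X Y) [Nonempty X] (ρ : ℝ) :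
    (0 : EReal) ≤ W.listCapacityFeedback ρ := by
  refine le_sSup ⟨0, rfl, fun n _ _ _ => Classical.arbitrary X, ?_⟩
  have : (fun n : ℕ => listMoment ρ (W.feedbackProb (fun (_ : Fin n)
      (_ : Fin (numMessages n 0)) _ => Classical.arbitrary X))) = fun _ => 1 := by
    funext n
    have hM : numMessages n 0 = 1 := by simp [numMessages]
    rw [listMoment]
    generalize numMessages n 0 = M at *
    subst hM
    have hp : ∀ (m : Fin 1) y, W.feedbackProb (fun (_ : Fin n) (_ : Fin 1) _ =>
        Classical.arbitrary X) m y = W.blockProb (fun _ _ => Classical.arbitrary X) m y :=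
      fun _ _ => rfl
    have hterm : ∀ (m : Fin 1) y, W.blockProb (fun (_ : Fin 1) (_ : Fin n) =>
        Classical.arbitrary X) m y * ((messageList (W.feedbackProb (fun (_ : Fin n) (_ : Fin 1) _ =>
        Classical.arbitrary X)) y).card : ℝ) ^ ρ = W.blockProb (fun _ _ => Classical.arbitrary X)
        m y := by
      intro m y
      rcases (W.blockProb_nonneg (fun (_ : Fin 1) (_ : Fin n) => Classical.arbitrary X) m
        y).eq_or_lt with h0 | hpos
      · rw [← h0, zero_mul]
      · have hcard : (messageList (W.feedbackProb (fun (_ : Fin n) (_ : Fin 1) _ =>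
            Classical.arbitrary X)) y).card = 1 := by
          rw [messageList, Finset.filter_true_of_mem fun m' _ => by
            rw [hp, Subsingleton.elim m' m]; exact hpos]
          simp
        rw [hcard]
        simp
    simp only [hp, hterm, sum_blockProb]
    simp
  rw [this]
  exact tendsto_const_nhds

end DMC

theorem theorem3 {X Y : Type*} [Fintype X] [Fintype Y] (W : DMC X Y) (ρ : ℝ) (hρ : 0 < ρ) :
    (0 < W.listCapacity ρ →
      ((if W.qstar = 1 then W.Rstar ρ
        else W.Rstar ρ / (1 + ρ * W.Rstar ρ / Real.log (1 / (1 - W.qstar))) : ℝ) : EReal)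
        ≤ W.listCapacityFeedback ρ) ∧
    (0 < W.zeroErrorCapacity → W.qstar = 1) := by
  refine ⟨fun h => ?_, W.qstar_eq_one_of_zeroErrorCapacity_pos⟩
  obtain ⟨hX, hq0⟩ := W.qstar_pos_of_listCapacity_pos hρ h
  obtain ⟨⟨x₁, x₀, Y₀, hx₀, hq⟩, -⟩ := W.qstar_isGreatest
  have hq1 : W.qstar ≤ 1 := by
    rw [hq, ← W.sum_eq_one x₁]
    exact Finset.sum_le_sum_of_subset_of_nonneg (Finset.subset_univ _) fun y _ _ => W.nonneg _ _
  refine EReal.ge_of_forall_gt_iff_ge.1 fun R hR => ?_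
  rw [EReal.coe_lt_coe_iff] at hR
  rcases le_or_gt R 0 with hR0 | hR0
  · exact le_trans (by exact_mod_cast hR0) (W.listCapacityFeedback_nonneg ρ)
  -- The last inequality lets `r` be chosen below `R⋆` with `R / r + ρ * R / l < 1`, since that
  -- condition amounts to `r > R * l / (l - ρ * R)`.
  have key : ∃ l, 0 < l ∧ 1 - W.qstar ≤ Real.exp (-l) ∧ ρ * R < l ∧
      R * l / (l - ρ * R) < W.Rstar ρ := by
    split_ifs at hR with h1
    · have hpos : 0 < W.Rstar ρ - R := sub_pos.2 hR
      -- For `q⋆ = 1` every `l` is admissible; the condition on `l` is `l * (R⋆ - R) > ρ * R * R⋆`,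
      -- and the summand `1` makes it strict.
      refine ⟨ρ * R * (W.Rstar ρ) / (W.Rstar ρ - R) + 1, by have := hR0.trans hR; positivity,
        by rw [h1, sub_self]; positivity, ?_⟩
      have h2 : ρ * R < ρ * R * (W.Rstar ρ) / (W.Rstar ρ - R) + 1 := by
        have : ρ * R ≤ ρ * R * (W.Rstar ρ) / (W.Rstar ρ - R) := by
          rw [le_div_iff₀ hpos]
          have := mul_pos hρ hR0
          nlinarith
        linarith
      refine ⟨h2, ?_⟩
      rw [div_lt_iff₀ (by linarith)]
      have : ρ * R * (W.Rstar ρ) / (W.Rstar ρ - R) * (W.Rstar ρ - R) = ρ * R * W.Rstar ρ :=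
        div_mul_cancel₀ _ hpos.ne'
      nlinarith
    · have hq1' : 0 < 1 - W.qstar := sub_pos.2 (lt_of_le_of_ne hq1 h1)
      have hl : 0 < Real.log (1 / (1 - W.qstar)) :=
        Real.log_pos (by rw [lt_div_iff₀ hq1']; linarith)
      have hexp : 1 - W.qstar ≤ Real.exp (-Real.log (1 / (1 - W.qstar))) := by
        rw [one_div, Real.log_inv, neg_neg, Real.exp_log hq1']
      generalize Real.log (1 / (1 - W.qstar)) = l at *
      have hS : 0 < W.Rstar ρ := by
        refine (W.Rstar_nonneg hρ).lt_of_ne' fun h0 => ?_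
        rw [h0, zero_div] at hR
        exact hR.not_gt hR0
      have hden : 0 < 1 + ρ * W.Rstar ρ / l := by positivity
      rw [lt_div_iff₀ hden] at hR
      have hmul : R * l + R * (ρ * W.Rstar ρ) < W.Rstar ρ * l := by
        have := mul_lt_mul_of_pos_right hR hl
        field_simp at this
        linarith
      have h2 : ρ * R < l := by
        have : 0 < W.Rstar ρ * (l - ρ * R) := by
          have := mul_pos hR0 hl
          linarith
        linarith [pos_of_mul_pos_right this hS.le]
      refine ⟨l, hl, hexp, h2, ?_⟩
      rw [div_lt_iff₀ (by linarith)]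
      linarith
  obtain ⟨l, hl, hexp, hRl, hs⟩ := key
  obtain ⟨ξ, hξ, P, hP⟩ := W.exists_E0_div_gt hρ hs
  have hr : 0 < W.E0 ξ P / (ξ + ρ) :=
    lt_trans (div_pos (mul_pos hR0 hl) (by linarith)) hP
  refine le_sSup ⟨R, rfl, W.exists_feedbackEncoder_tendsto hρ hξ hR0 hr hl P
    (div_mul_cancel₀ _ (by linarith)).symm hx₀ (hq ▸ hexp) ?_⟩
  generalize W.E0 ξ P / (ξ + ρ) = r at *
  rw [div_lt_iff₀ (by linarith)] at hP
  rw [div_add_div _ _ hr.ne' hl.ne', div_lt_one (mul_pos hr hl)]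
  linarith
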